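/- Let $L$ be a completely regular frame and let $\mathcal{R}L$ be the ring of real-valued continuous functions on $L$, i.e. of the frame homomorphisms $\mathcal{L}(\mathbb{R})\to L$, where the frame of reals $\mathcal{L}(\mathbb{R})$ is generated by the pairs $(p,q)$ of rationals subject to $(p,q)\wedge(r,s)=(p\vee r,q\wedge s)$; $(p,q)\vee(r,s)=(p,s)$ whenever $p\le r<q\le s$; $(p,q)=\bigvee\{(r,s)\mid p<r<s<q\}$; and $1=\bigvee\{(p,q)\mid p,q\in\mathbb{Q}\}$. Sum and product ($\diamond\in\{+,\cdot\}$) are given by $(\varphi\diamond\psi)(p,q)=\bigvee\{\varphi(r,s)\wedge\psi(t,u)\mid \langle r,s\rangle\diamond\langle t,u\rangle\subseteq\langle p,q\rangle\}$, where $\langle r,s\rangle=\{x\in\mathbb{Q}\mid r<x<s\}$. For $\varphi\in\mathcal{R}L$ put $\operatorname{coz}\varphi=\bigvee\{\varphi(p,0)\vee\varphi(0,q)\mid p,q\in\mathbb{Q}\}$; the elements of this form are the cozero elements of $L$. Write $a^*$ for the pseudocomplement of $a\in L$. The frame $L$ is a $P_F$-frame if, whenever $a,b\in L$ are cozero elements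 with $a\wedge b=0$, at least one of $a,b$ is complemented in $L$. An ideal $I$ of $\mathcal{R}L$ is a $d$-ideal if for all $\alpha\in\mathcal{R}L$ and $f\in I$, $\operatorname{coz}\alpha\le(\operatorname{coz}f)^{**}$ implies $\alpha\in I$. The following statements are equivalent. 1. The sum of any two $d$-ideals of $\mathcal{R}L$ is a $d$-ideal or all of $\mathcal{R}L$, and of any two ideals of $\mathcal{R}L$ whose sum is a proper $d$-ideal, at least one is a $d$-ideal. 2. $L$ is a $P_F$-frame. 3. Of any two ideals of $\mathcal{R}L$ whose intersection is a $d$-ideal, at least one is a $d$-ideal. -/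

import Mathlib

open TopologicalSpace

namespace PointfreeReal

universe u

/-! ### Frames: complete regularity -/

/-- `a` is rather below `b`: some `t` has `a ∧ t = 0` and `t ∨ b = 1`. -/
def RatherBelow {L : Type u} [Order.Frame L] (a b : L) : Prop :=
  ∃ t : L, a ⊓ t = ⊥ ∧ t ⊔ b = ⊤

/-- `a` is completely below `b`: there is a family `c` indexed by the rationals in `[0, 1]` with
`c 0 = a`, `c 1 = b` and `c r` rather below `c s` whenever `r < s`. -/
def CompletelyBelow {L : Type u} [Order.Frame L] (a b : L) : Prop :=
  ∃ c : Set.Icc (0 : ℚ) 1 → L, c 0 = a ∧ c 1 = b ∧ ∀ r s, r < s → RatherBelow (c r) (c s)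

/-- A frame is completely regular if each element is the join of those completely below it. -/
def IsCompletelyRegular (L : Type u) [Order.Frame L] : Prop :=
  ∀ a : L, a = sSup {x : L | CompletelyBelow x a}

/-! ### Real-valued continuous functions on a frame -/

/-- The underlying set of `ℛL`.  The frame of reals is the frame generated by the pairs `(p, q)`
of rationals subject to the four relations below, so that a frame homomorphism from it to `L` is
precisely a map `ℚ × ℚ → L` that respects these relations. -/
@[ext]
structure RL (L : Type u) [Order.Frame L] where
  /-- the value at the generator `(p, q)` -/
  toFun : ℚ → ℚ → L
  inf_eq : ∀ p q r s, toFun p q ⊓ toFun r s = toFun (max p r) (min q s)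
  sup_eq : ∀ p q r s, p ≤ r → r < q → q ≤ s → toFun p q ⊔ toFun r s = toFun p s
  eq_iSup : ∀ p q, toFun p q = ⨆ (r : ℚ) (s : ℚ) (_ : p < r ∧ r < s ∧ s < q), toFun r s
  iSup_eq : ⨆ (p : ℚ) (q : ℚ), toFun p q = ⊤

/-! ### Frame homomorphisms on open sets

The frame of reals is isomorphic to `Opens ℝ`; this is used to verify the ring laws of `ℛL`. -/

section homs

variable {L : Type u} [Order.Frame L] {X Y : Type} [TopologicalSpace X] [TopologicalSpace Y]

/-- The product of two open sets. -/
def box (U : Opens X) (V : Opens Y) : Opens (X × Y) := ⟨U ×ˢ V, U.isOpen.prod V.isOpen⟩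

theorem le_sSup_box [LocallyCompactSpace X] (φ : FrameHom (Opens X) L) (ψ : FrameHom (Opens Y) L)
    (U : Opens X) (V : Opens Y) (S : Set (Opens (X × Y))) (h : box U V ≤ sSup S) (T : L)
    (hT : ∀ W ∈ S, ∀ A B, box A B ≤ W → φ A ⊓ ψ B ≤ T) : φ U ⊓ ψ V ≤ T := by
  have hU : U = sSup {A : Opens X | ∃ K : Set X, IsCompact K ∧ (A : Set X) ⊆ K ∧ K ⊆ U} := by
    apply le_antisymm
    · intro x hx
      obtain ⟨K, hK, hxK, hKU⟩ := exists_compact_subset U.isOpen hx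
      rw [Opens.mem_sSup]
      exact ⟨⟨interior K, isOpen_interior⟩, ⟨K, hK, interior_subset, hKU⟩, hxK⟩
    · apply sSup_le
      rintro A ⟨K, -, h1, h2⟩
      exact h1.trans h2
  rw [hU, map_sSup, sSup_inf_eq]
  apply iSup₂_le
  rintro _ ⟨A, ⟨K, hK, hAK, hKU⟩, rfl⟩
  -- vary the second coordinate
  have hV : V ≤ sSup {B : Opens Y | φ A ⊓ ψ B ≤ T} := by
    intro y hy
    rw [Opens.mem_sSup]
    have key : ∃ B : Opens Y, y ∈ B ∧ ∃ C : Opens X, K ⊆ C ∧ φ C ⊓ ψ B ≤ T := by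
      refine hK.induction_on (p := fun K => ∃ B : Opens Y, y ∈ B ∧ ∃ C : Opens X, K ⊆ C ∧
        φ C ⊓ ψ B ≤ T) ?_ ?_ ?_ ?_
      · exact ⟨⊤, trivial, ⊥, by simp, by simp⟩
      · rintro s t hst ⟨B, hB, C, hC, h⟩
        exact ⟨B, hB, C, hst.trans hC, h⟩
      · rintro s t ⟨B, hB, C, hC, h⟩ ⟨B', hB', C', hC', h'⟩
        refine ⟨B ⊓ B', ⟨hB, hB'⟩, C ⊔ C', ?_, ?_⟩
        · rw [Opens.coe_sup]; exact Set.union_subset_union hC hC'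
        · rw [map_sup, inf_sup_right]
          exact sup_le ((inf_le_inf_left _ (OrderHomClass.mono ψ inf_le_left)).trans h)
            ((inf_le_inf_left _ (OrderHomClass.mono ψ inf_le_right)).trans h')
      · intro x hx
        have hxy : (x, y) ∈ sSup S := h (show (x, y) ∈ (U : Set X) ×ˢ (V : Set Y) from ⟨hKU hx, hy⟩)
        rw [Opens.mem_sSup] at hxy
        obtain ⟨W, hW, hxW⟩ := hxy
        obtain ⟨A', B', hA', hB', hxA, hyB, hAB⟩ := isOpen_prod_iff.1 W.isOpen x y hxW
        exact ⟨A', mem_nhdsWithin_of_mem_nhds (hA'.mem_nhds hxA), ⟨B', hB'⟩, hyB, ⟨A', hA'⟩,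
          subset_rfl, hT W hW _ _ hAB⟩
    obtain ⟨B, hyB, C, hKC, h⟩ := key
    exact ⟨B, (inf_le_inf_right _ (OrderHomClass.mono φ (hAK.trans hKC : A ≤ C))).trans h, hyB⟩
  refine (inf_le_inf_left _ (OrderHomClass.mono ψ hV)).trans ?_
  rw [map_sSup, inf_sSup_eq]
  apply iSup₂_le
  rintro _ ⟨B, hB, rfl⟩
  exact hB

/-- The frame homomorphism on `Opens (X × Y)` induced by homomorphisms on the two factors. -/
def pair [LocallyCompactSpace X] (φ : FrameHom (Opens X) L) (ψ : FrameHom (Opens Y) L) :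
    FrameHom (Opens (X × Y)) L where
  toFun W := ⨆ (A : Opens X) (B : Opens Y) (_ : box A B ≤ W), φ A ⊓ ψ B
  map_inf' W W' := by
    apply le_antisymm
    · refine iSup_le fun A => iSup_le fun B => iSup_le fun h => le_inf ?_ ?_
      · exact le_iSup_of_le A (le_iSup_of_le B (le_iSup_of_le (h.trans inf_le_left) le_rfl))
      · exact le_iSup_of_le A (le_iSup_of_le B (le_iSup_of_le (h.trans inf_le_right) le_rfl))
    · simp only [iSup_inf_eq, inf_iSup_eq]
      refine iSup_le fun A => iSup_le fun B => iSup_le fun h => iSup_le fun A' => iSup_le fun B' =>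
        iSup_le fun h' => ?_
      refine le_iSup_of_le (A ⊓ A') (le_iSup_of_le (B ⊓ B') (le_iSup_of_le ?_ ?_))
      · rintro ⟨x, y⟩ ⟨⟨h1, h2⟩, h3, h4⟩
        exact ⟨h' (show (x, y) ∈ (A' : Set X) ×ˢ (B' : Set Y) from ⟨h2, h4⟩),
          h (show (x, y) ∈ (A : Set X) ×ˢ (B : Set Y) from ⟨h1, h3⟩)⟩
      · rw [map_inf, map_inf, inf_inf_inf_comm, inf_comm (φ A'), inf_comm (ψ B'),
          inf_inf_inf_comm, inf_inf_inf_comm]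
  map_top' := by
    rw [eq_top_iff]
    exact le_iSup_of_le ⊤ (le_iSup_of_le ⊤ (le_iSup_of_le le_top (by simp)))
  map_sSup' S := by
    apply le_antisymm
    · refine iSup_le fun A => iSup_le fun B => iSup_le fun h => ?_
      refine le_sSup_box φ ψ A B S h _ fun W hW A' B' h' => ?_
      exact le_sSup_of_le ⟨W, hW, rfl⟩
        (le_iSup_of_le A' (le_iSup_of_le B' (le_iSup_of_le h' le_rfl)))
    · apply sSup_le
      rintro _ ⟨W, hW, rfl⟩
      refine iSup_le fun A => iSup_le fun B => iSup_le fun h => ?_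
      exact le_iSup_of_le A (le_iSup_of_le B (le_iSup_of_le (h.trans (le_sSup hW)) le_rfl))

theorem pair_apply [LocallyCompactSpace X] (φ : FrameHom (Opens X) L) (ψ : FrameHom (Opens Y) L)
    (W : Opens (X × Y)) :
    pair φ ψ W = ⨆ (A : Opens X) (B : Opens Y) (_ : box A B ≤ W), φ A ⊓ ψ B := rfl

/-- A homomorphism on `Opens (X × Y)` is determined by its restrictions to the factors. -/
theorem pair_comap [LocallyCompactSpace X] (H : FrameHom (Opens (X × Y)) L) :
    pair (H.comp (Opens.comap ⟨Prod.fst, continuous_fst⟩))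
      (H.comp (Opens.comap ⟨Prod.snd, continuous_snd⟩)) = H := by
  have hb : ∀ (A : Opens X) (B : Opens Y), (H.comp (Opens.comap ⟨Prod.fst, continuous_fst⟩)) A ⊓
      (H.comp (Opens.comap ⟨Prod.snd, continuous_snd⟩)) B = H (box A B) := by
    intro A B
    simp only [FrameHom.comp_apply]
    rw [← map_inf]
    rfl
  ext W
  rw [pair_apply]
  simp only [hb]
  apply le_antisymm
  · exact iSup_le fun A => iSup_le fun B => iSup_le fun h => OrderHomClass.mono H h
  · have hW : W ≤ ⨆ (A : Opens X) (B : Opens Y) (_ : box A B ≤ W), box A B := by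
      rintro ⟨x, y⟩ hxy
      obtain ⟨A', B', hA', hB', hxA, hyB, hAB⟩ := isOpen_prod_iff.1 W.isOpen x y hxy
      have : box ⟨A', hA'⟩ ⟨B', hB'⟩ ≤ ⨆ (A : Opens X) (B : Opens Y) (_ : box A B ≤ W), box A B :=
        le_iSup_of_le (⟨A', hA'⟩ : Opens X) (le_iSup_of_le (⟨B', hB'⟩ : Opens Y)
          (le_iSup_of_le hAB le_rfl))
      exact this (show (x, y) ∈ A' ×ˢ B' from ⟨hxA, hyB⟩)
    refine (OrderHomClass.mono H hW).trans ?_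
    simp only [map_iSup]
    exact le_rfl

theorem pair_fst [LocallyCompactSpace X] (φ : FrameHom (Opens X) L) (ψ : FrameHom (Opens Y) L) :
    (pair φ ψ).comp (Opens.comap ⟨Prod.fst, continuous_fst⟩) = φ := by
  ext U
  apply le_antisymm
  · rw [FrameHom.comp_apply, pair_apply]
    refine iSup_le fun A => iSup_le fun B => iSup_le fun h => ?_
    rcases (B : Set Y).eq_empty_or_nonempty with hB | ⟨y, hy⟩
    · have : B = ⊥ := Opens.ext hB
      simp [this]
    · refine inf_le_left.trans (OrderHomClass.mono φ fun x hx => ?_)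
      exact h (show (x, y) ∈ (A : Set X) ×ˢ (B : Set Y) from ⟨hx, hy⟩)
  · rw [FrameHom.comp_apply, pair_apply]
    refine le_iSup_of_le U (le_iSup_of_le ⊤ (le_iSup_of_le (fun x hx => hx.1) (by simp)))

theorem pair_snd [LocallyCompactSpace X] (φ : FrameHom (Opens X) L) (ψ : FrameHom (Opens Y) L) :
    (pair φ ψ).comp (Opens.comap ⟨Prod.snd, continuous_snd⟩) = ψ := by
  ext U
  apply le_antisymm
  · rw [FrameHom.comp_apply, pair_apply]
    refine iSup_le fun A => iSup_le fun B => iSup_le fun h => ?_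
    rcases (A : Set X).eq_empty_or_nonempty with hA | ⟨x, hx⟩
    · have : A = ⊥ := Opens.ext hA
      simp [this]
    · refine inf_le_right.trans (OrderHomClass.mono ψ fun y hy => ?_)
      exact h (show (x, y) ∈ (A : Set X) ×ˢ (B : Set Y) from ⟨hx, hy⟩)
  · rw [FrameHom.comp_apply, pair_apply]
    refine le_iSup_of_le ⊤ (le_iSup_of_le U (le_iSup_of_le (fun x hx => hx.2) (by simp)))

/-- The binary operation on homomorphisms induced by a continuous operation on `ℝ`. -/
def op (g : C(ℝ × ℝ, ℝ)) (φ ψ : FrameHom (Opens ℝ) L) : FrameHom (Opens ℝ) L :=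
  (pair φ ψ).comp (Opens.comap g)

theorem op_comap (g : C(ℝ × ℝ, ℝ)) (T : FrameHom (Opens X) L) (a b : C(X, ℝ)) :
    op g (T.comp (Opens.comap a)) (T.comp (Opens.comap b)) =
      T.comp (Opens.comap (g.comp (a.prodMk b))) := by
  have h := pair_comap (T.comp (Opens.comap (a.prodMk b)))
  have ha : (T.comp (Opens.comap (a.prodMk b))).comp (Opens.comap ⟨Prod.fst, continuous_fst⟩)
      = T.comp (Opens.comap a) := rfl
  have hb : (T.comp (Opens.comap (a.prodMk b))).comp (Opens.comap ⟨Prod.snd, continuous_snd⟩)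
      = T.comp (Opens.comap b) := rfl
  rw [ha, hb] at h
  rw [op, h]
  rfl

/-- Any three homomorphisms factor through one space. -/
theorem exists_common (φ ψ χ : FrameHom (Opens ℝ) L) :
    ∃ (T : FrameHom (Opens ((ℝ × ℝ) × ℝ)) L) (a b c : C((ℝ × ℝ) × ℝ, ℝ)),
      φ = T.comp (Opens.comap a) ∧ ψ = T.comp (Opens.comap b) ∧ χ = T.comp (Opens.comap c) := by
  refine ⟨pair (pair φ ψ) χ, ⟨fun x => x.1.1, by fun_prop⟩, ⟨fun x => x.1.2, by fun_prop⟩,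
    ⟨fun x => x.2, by fun_prop⟩, ?_, ?_, ?_⟩
  · have h := congrArg (fun H : FrameHom (Opens (ℝ × ℝ)) L =>
      H.comp (Opens.comap ⟨Prod.fst, continuous_fst⟩)) (pair_fst (pair φ ψ) χ)
    exact ((h.trans (pair_fst φ ψ))).symm
  · have h := congrArg (fun H : FrameHom (Opens (ℝ × ℝ)) L =>
      H.comp (Opens.comap ⟨Prod.snd, continuous_snd⟩)) (pair_fst (pair φ ψ) χ)
    exact ((h.trans (pair_snd φ ψ))).symm
  · exact (pair_snd (pair φ ψ) χ).symm

end homs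

/-! ### Elements of `ℛL` and homomorphisms on `Opens ℝ` -/

/-- The open interval of reals with given rational endpoints. -/
def ival (p q : ℚ) : Opens ℝ := ⟨Set.Ioo (p : ℝ) q, isOpen_Ioo⟩

theorem mem_ival {p q : ℚ} {x : ℝ} : x ∈ ival p q ↔ (p : ℝ) < x ∧ x < q := Iff.rfl

theorem ival_le {p q r s : ℚ} (hrs : r < s) (h : ival r s ≤ ival p q) : p ≤ r ∧ s ≤ q := by
  have h' := (Set.Ioo_subset_Ioo_iff (show (r : ℝ) < s by exact_mod_cast hrs)).1
    (show Set.Ioo (r : ℝ) s ⊆ Set.Ioo (p : ℝ) q from h)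
  exact ⟨by exact_mod_cast h'.1, by exact_mod_cast h'.2⟩

theorem exists_ival (U : Opens ℝ) {x : ℝ} (hx : x ∈ U) :
    ∃ p q : ℚ, x ∈ ival p q ∧ ival p q ≤ U := by
  obtain ⟨a, b, ⟨ha, hb⟩, hab⟩ := mem_nhds_iff_exists_Ioo_subset.1 (U.isOpen.mem_nhds hx)
  obtain ⟨p, hp1, hp2⟩ := exists_rat_btwn ha
  obtain ⟨q, hq1, hq2⟩ := exists_rat_btwn hb
  exact ⟨p, q, ⟨hp2, hq1⟩, fun y hy => hab ⟨hp1.trans hy.1, hy.2.trans hq2⟩⟩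

theorem eq_iSup_ival (U : Opens ℝ) : U = ⨆ (p : ℚ) (q : ℚ) (_ : ival p q ≤ U), ival p q := by
  apply le_antisymm
  · intro x hx
    obtain ⟨p, q, hxpq, h⟩ := exists_ival U hx
    have : ival p q ≤ ⨆ (p : ℚ) (q : ℚ) (_ : ival p q ≤ U), ival p q :=
      le_iSup_of_le p (le_iSup_of_le q (le_iSup_of_le h le_rfl))
    exact this hxpq
  · exact iSup_le fun p => iSup_le fun q => iSup_le fun h => h

namespace RL

variable {L : Type u} [Order.Frame L]

/-- Restriction of a homomorphism on `Opens ℝ` to the rational intervals. -/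
def ofHom (H : FrameHom (Opens ℝ) L) : RL L where
  toFun p q := H (ival p q)
  inf_eq p q r s := by
    rw [← map_inf]
    congr 1
    apply Opens.ext
    simp [ival, Set.Ioo_inter_Ioo]
  sup_eq p q r s h1 h2 h3 := by
    rw [← map_sup]
    congr 1
    have h1' : (p : ℝ) ≤ r := by exact_mod_cast h1
    have h2' : (r : ℝ) < q := by exact_mod_cast h2
    have h3' : (q : ℝ) ≤ s := by exact_mod_cast h3
    apply Opens.ext
    ext x
    simp only [ival, Opens.coe_sup, Opens.coe_mk, Set.mem_union, Set.mem_Ioo]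
    constructor
    · rintro (⟨ha, hb⟩ | ⟨ha, hb⟩)
      · exact ⟨ha, hb.trans_le h3'⟩
      · exact ⟨h1'.trans_lt ha, hb⟩
    · rintro ⟨ha, hb⟩
      rcases lt_or_ge x q with h | h
      · exact Or.inl ⟨ha, h⟩
      · exact Or.inr ⟨h2'.trans_le h, hb⟩
  eq_iSup p q := by
    simp only [← map_iSup]
    congr 1
    apply le_antisymm
    · rintro x ⟨hx1, hx2⟩
      obtain ⟨r, hr1, hr2⟩ := exists_rat_btwn hx1
      obtain ⟨s, hs1, hs2⟩ := exists_rat_btwn hx2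
      have : ival r s ≤ ⨆ (r : ℚ) (s : ℚ) (_ : p < r ∧ r < s ∧ s < q), ival r s :=
        le_iSup_of_le r (le_iSup_of_le s (le_iSup_of_le
          ⟨by exact_mod_cast hr1, by exact_mod_cast hr2.trans hs1, by exact_mod_cast hs2⟩ le_rfl))
      exact this ⟨hr2, hs1⟩
    · refine iSup_le fun r => iSup_le fun s => iSup_le fun h => ?_
      rintro x ⟨hx1, hx2⟩
      exact ⟨lt_trans (by exact_mod_cast h.1) hx1, lt_trans hx2 (by exact_mod_cast h.2.2)⟩
  iSup_eq := by
    simp only [← map_iSup]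
    rw [← map_top H]
    congr 1
    rw [eq_top_iff]
    refine (eq_iSup_ival ⊤).le.trans ?_
    simp

theorem mono (φ : RL L) {p q r s : ℚ} (h1 : p ≤ r) (h2 : s ≤ q) : φ.toFun r s ≤ φ.toFun p q := by
  have := φ.inf_eq p q r s
  rw [max_eq_right h1, min_eq_right h2] at this
  exact inf_eq_right.1 this

theorem eq_bot (φ : RL L) {p q : ℚ} (h : q ≤ p) : φ.toFun p q = ⊥ := by
  rw [φ.eq_iSup, eq_bot_iff]
  refine iSup_le fun r => iSup_le fun s => iSup_le fun h' => ?_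
  exact absurd (h'.1.trans (h'.2.1.trans h'.2.2)) (not_lt.2 h)

theorem le_of_ival_le (φ : RL L) {p q r s : ℚ} (h : ival r s ≤ ival p q) :
    φ.toFun r s ≤ φ.toFun p q := by
  rcases lt_or_ge r s with hrs | hrs
  · exact φ.mono (ival_le hrs h).1 (ival_le hrs h).2
  · rw [φ.eq_bot hrs]; exact bot_le

theorem le_of_small (φ : RL L) {r s h : ℚ} (hh : 0 < h) (T : L)
    (hT : ∀ p q, r ≤ p → p < q → q ≤ s → q - p ≤ h → φ.toFun p q ≤ T) (n : ℕ) :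
    ∀ p q, r ≤ p → q ≤ s → q - p ≤ n * (h / 2) → φ.toFun p q ≤ T := by
  induction n with
  | zero =>
    intro p q _ _ h3
    rw [φ.eq_bot (by simpa using h3)]
    exact bot_le
  | succ n ih =>
    intro p q h1 h2 h3
    rcases le_or_gt q p with hqp | hpq
    · rw [φ.eq_bot hqp]; exact bot_le
    rcases le_or_gt (q - p) h with hs | hs
    · exact hT p q h1 hpq h2 hs
    rw [← φ.sup_eq p (p + h) (p + h / 2) q (by linarith) (by linarith) (by linarith)]
    apply sup_le
    · exact hT _ _ h1 (by linarith) (by linarith) (by linarith)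
    · apply ih _ _ (by linarith) h2
      push_cast at h3
      linarith

theorem le_of_cover (φ : RL L) (S : Set (Opens ℝ)) {p q : ℚ} (h : ival p q ≤ sSup S) (T : L)
    (hT : ∀ U ∈ S, ∀ r s, ival r s ≤ U → φ.toFun r s ≤ T) : φ.toFun p q ≤ T := by
  rw [φ.eq_iSup]
  refine iSup_le fun r => iSup_le fun s => iSup_le fun hrs => ?_
  have hr : (p : ℝ) < r := by exact_mod_cast hrs.1
  have hs : (s : ℝ) < q := by exact_mod_cast hrs.2.2
  obtain ⟨δ, hδ, hball⟩ := lebesgue_number_lemma_of_metric_sUnion (s := Set.Icc (r : ℝ) s)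
    (c := (fun U : Opens ℝ => (U : Set ℝ)) '' S) isCompact_Icc
    (by rintro _ ⟨U, -, rfl⟩; exact U.isOpen)
    (by
      intro x hx
      have hx' : x ∈ sSup S := h ⟨hr.trans_le hx.1, hx.2.trans_lt hs⟩
      rw [Opens.mem_sSup] at hx'
      obtain ⟨U, hU, hxU⟩ := hx'
      exact ⟨U, ⟨U, hU, rfl⟩, hxU⟩)
  obtain ⟨d, hd0, hd⟩ := exists_rat_btwn hδ
  have hd0' : 0 < d := by exact_mod_cast hd0
  obtain ⟨n, hn⟩ := exists_nat_gt ((s - r) / (d / 2))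
  refine φ.le_of_small (r := r) (s := s) hd0' T ?_ n r s le_rfl le_rfl ?_
  · intro a b ha hab hb hd'
    have ha' : (r : ℝ) ≤ a := by exact_mod_cast ha
    have hab' : (a : ℝ) < b := by exact_mod_cast hab
    have hb' : (b : ℝ) ≤ s := by exact_mod_cast hb
    have hd'' : (b : ℝ) - a ≤ d := by exact_mod_cast hd'
    obtain ⟨_, ⟨U, hU, rfl⟩, hsub⟩ := hball a ⟨ha', by linarith⟩
    refine hT U hU a b fun x hx => hsub ?_
    rw [Metric.mem_ball, Real.dist_eq, abs_lt]
    have := hx.1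
    have := hx.2
    constructor <;> linarith
  · rw [div_lt_iff₀ (by positivity)] at hn
    exact hn.le

/-- Extension of an element of `ℛL` to a frame homomorphism on `Opens ℝ`. -/
def toHom (φ : RL L) : FrameHom (Opens ℝ) L where
  toFun U := ⨆ (p : ℚ) (q : ℚ) (_ : ival p q ≤ U), φ.toFun p q
  map_inf' U V := by
    apply le_antisymm
    · refine iSup_le fun p => iSup_le fun q => iSup_le fun h => le_inf ?_ ?_
      · exact le_iSup_of_le p (le_iSup_of_le q (le_iSup_of_le (h.trans inf_le_left) le_rfl))
      · exact le_iSup_of_le p (le_iSup_of_le q (le_iSup_of_le (h.trans inf_le_right) le_rfl))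
    · simp only [iSup_inf_eq, inf_iSup_eq]
      refine iSup_le fun p => iSup_le fun q => iSup_le fun h => iSup_le fun r => iSup_le fun s =>
        iSup_le fun h' => ?_
      refine le_iSup_of_le _ (le_iSup_of_le _ (le_iSup_of_le ?_ (φ.inf_eq _ _ _ _).le))
      rintro x ⟨hx1, hx2⟩
      push_cast at hx1 hx2
      rw [max_lt_iff] at hx1
      rw [lt_min_iff] at hx2
      exact ⟨h' ⟨hx1.1, hx2.1⟩, h ⟨hx1.2, hx2.2⟩⟩
  map_top' := by
    simp only [le_top, iSup_pos]
    exact φ.iSup_eq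
  map_sSup' S := by
    apply le_antisymm
    · refine iSup_le fun p => iSup_le fun q => iSup_le fun h => ?_
      refine φ.le_of_cover S h _ fun U hU r s h' => ?_
      exact le_sSup_of_le ⟨U, hU, rfl⟩
        (le_iSup_of_le r (le_iSup_of_le s (le_iSup_of_le h' le_rfl)))
    · apply sSup_le
      rintro _ ⟨U, hU, rfl⟩
      refine iSup_le fun p => iSup_le fun q => iSup_le fun h => ?_
      exact le_iSup_of_le p (le_iSup_of_le q (le_iSup_of_le (h.trans (le_sSup hU)) le_rfl))

theorem toHom_apply (φ : RL L) (U : Opens ℝ) :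
    φ.toHom U = ⨆ (p : ℚ) (q : ℚ) (_ : ival p q ≤ U), φ.toFun p q := rfl

theorem toHom_ival (φ : RL L) (p q : ℚ) : φ.toHom (ival p q) = φ.toFun p q := by
  apply le_antisymm
  · exact iSup_le fun r => iSup_le fun s => iSup_le fun h => φ.le_of_ival_le h
  · exact le_iSup_of_le p (le_iSup_of_le q (le_iSup_of_le le_rfl le_rfl))

theorem ofHom_toHom (φ : RL L) : ofHom φ.toHom = φ := by
  ext p q
  exact φ.toHom_ival p q

theorem toHom_ofHom (H : FrameHom (Opens ℝ) L) : (ofHom H).toHom = H := by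
  ext U
  conv_rhs => rw [eq_iSup_ival U]
  simp only [map_iSup]
  rfl

theorem toHom_injective : Function.Injective (toHom : RL L → FrameHom (Opens ℝ) L) :=
  Function.LeftInverse.injective ofHom_toHom

/-! ### The ring operations -/

/-- The value `(φ ◇ ψ)(p, q) = ⋁ {φ(r, s) ∧ ψ(t, u) | ⟨r, s⟩ ◇ ⟨t, u⟩ ⊆ ⟨p, q⟩}`, where `⟨r, s⟩` is
the set of rationals strictly between `r` and `s`. -/
def opVal (o : ℚ → ℚ → ℚ) (φ ψ : RL L) (p q : ℚ) : L :=
  ⨆ (r : ℚ) (s : ℚ) (t : ℚ) (v : ℚ)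
    (_ : ∀ x ∈ Set.Ioo r s, ∀ y ∈ Set.Ioo t v, o x y ∈ Set.Ioo p q), φ.toFun r s ⊓ ψ.toFun t v

theorem opVal_eq (o : ℚ → ℚ → ℚ) (g : C(ℝ × ℝ, ℝ)) (hg : ∀ x y : ℚ, g (x, y) = (o x y : ℚ))
    (hb : ∀ (x y : ℝ) (a b c d : ℚ), (a : ℝ) < x → x < b → (c : ℝ) < y → y < d →
      g (x, y) ∈ convexHull ℝ {g (a, c), g (a, d), g (b, c), g (b, d)})
    (φ ψ : RL L) (p q : ℚ) : opVal o φ ψ p q = op g φ.toHom ψ.toHom (ival p q) := by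
  apply le_antisymm
  · refine iSup_le fun r => iSup_le fun s => iSup_le fun t => iSup_le fun v => iSup_le fun h => ?_
    rw [op, FrameHom.comp_apply, pair_apply]
    refine le_iSup_of_le (ival r s) (le_iSup_of_le (ival t v) (le_iSup_of_le ?_ ?_))
    · rintro ⟨x, y⟩ ⟨⟨hx1, hx2⟩, hy1, hy2⟩
      obtain ⟨a, ha1, ha2⟩ := exists_rat_btwn hx1
      obtain ⟨b, hb1, hb2⟩ := exists_rat_btwn hx2
      obtain ⟨c, hc1, hc2⟩ := exists_rat_btwn hy1
      obtain ⟨d, hd1, hd2⟩ := exists_rat_btwn hy2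
      dsimp only at ha2 hb1 hc2 hd1
      have ha : a ∈ Set.Ioo r s :=
        ⟨by exact_mod_cast ha1, by exact_mod_cast ha2.trans (hb1.trans hb2)⟩
      have hb' : b ∈ Set.Ioo r s :=
        ⟨by exact_mod_cast ha1.trans (ha2.trans hb1), by exact_mod_cast hb2⟩
      have hc : c ∈ Set.Ioo t v :=
        ⟨by exact_mod_cast hc1, by exact_mod_cast hc2.trans (hd1.trans hd2)⟩
      have hd : d ∈ Set.Ioo t v :=
        ⟨by exact_mod_cast hc1.trans (hc2.trans hd1), by exact_mod_cast hd2⟩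
      have key : ∀ x ∈ Set.Ioo r s, ∀ y ∈ Set.Ioo t v, g (x, y) ∈ Set.Ioo (p : ℝ) q := by
        intro x hx y hy
        rw [hg]
        exact ⟨by exact_mod_cast (h x hx y hy).1, by exact_mod_cast (h x hx y hy).2⟩
      refine convexHull_min ?_ (convex_Ioo (p : ℝ) q) (hb x y a b c d ha2 hb1 hc2 hd1)
      rintro z (rfl | rfl | rfl | rfl)
      · exact key a ha c hc
      · exact key a ha d hd
      · exact key b hb' c hc
      · exact key b hb' d hd
    · rw [toHom_ival, toHom_ival]
  · rw [op, FrameHom.comp_apply, pair_apply]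
    refine iSup_le fun A => iSup_le fun B => iSup_le fun h => ?_
    rw [toHom_apply, toHom_apply]
    simp only [iSup_inf_eq, inf_iSup_eq]
    refine iSup_le fun r => iSup_le fun s => iSup_le fun hA => iSup_le fun t => iSup_le fun v =>
      iSup_le fun hB => ?_
    have fin : ∀ r s t v : ℚ, ival r s ≤ A → ival t v ≤ B →
        φ.toFun r s ⊓ ψ.toFun t v ≤ opVal o φ ψ p q := by
      intro r s t v hA hB
      refine le_iSup_of_le r (le_iSup_of_le s (le_iSup_of_le t (le_iSup_of_le v
        (le_iSup_of_le ?_ le_rfl))))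
      rintro x ⟨hx1, hx2⟩ y ⟨hy1, hy2⟩
      have hx : (x : ℝ) ∈ A := hA ⟨by exact_mod_cast hx1, by exact_mod_cast hx2⟩
      have hy : (y : ℝ) ∈ B := hB ⟨by exact_mod_cast hy1, by exact_mod_cast hy2⟩
      have hxy : g ((x : ℝ), (y : ℝ)) ∈ Set.Ioo (p : ℝ) q :=
        h (show ((x : ℝ), (y : ℝ)) ∈ (A : Set ℝ) ×ˢ (B : Set ℝ) from ⟨hx, hy⟩)
      rw [hg] at hxy
      exact ⟨by exact_mod_cast hxy.1, by exact_mod_cast hxy.2⟩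
    exact fin t v r s hB hA

/-- Addition on `ℝ` as a continuous map. -/
def addMap : C(ℝ × ℝ, ℝ) := ⟨fun x => x.1 + x.2, by fun_prop⟩

/-- Multiplication on `ℝ` as a continuous map. -/
def mulMap : C(ℝ × ℝ, ℝ) := ⟨fun x => x.1 * x.2, by fun_prop⟩

theorem bilin_mem (g : ℝ → ℝ → ℝ)
    (h1 : ∀ y a b s t : ℝ, s + t = 1 → g (s * a + t * b) y = s * g a y + t * g b y)
    (h2 : ∀ x a b s t : ℝ, s + t = 1 → g x (s * a + t * b) = s * g x a + t * g x b)
    (x y a b c d : ℝ) (ha : a < x) (hb : x < b) (hc : c < y) (hd : y < d) :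
    g x y ∈ convexHull ℝ {g a c, g a d, g b c, g b d} := by
  have hconv := convex_convexHull ℝ ({g a c, g a d, g b c, g b d} : Set ℝ)
  have hsub := subset_convexHull ℝ ({g a c, g a d, g b c, g b d} : Set ℝ)
  obtain ⟨s, t, hs, ht, hst, hx⟩ : x ∈ segment ℝ a b := by
    rw [segment_eq_Icc (ha.trans hb).le]; exact ⟨ha.le, hb.le⟩
  obtain ⟨s', t', hs', ht', hst', hy⟩ : y ∈ segment ℝ c d := by
    rw [segment_eq_Icc (hc.trans hd).le]; exact ⟨hc.le, hd.le⟩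
  simp only [smul_eq_mul] at hx hy
  rw [← hx, h1 _ _ _ _ _ hst]
  refine hconv ?_ ?_ hs ht hst
  · rw [← hy, h2 _ _ _ _ _ hst']
    exact hconv (hsub (by simp)) (hsub (by simp)) hs' ht' hst'
  · rw [← hy, h2 _ _ _ _ _ hst']
    exact hconv (hsub (by simp)) (hsub (by simp)) hs' ht' hst'

theorem opVal_add (φ ψ : RL L) :
    opVal (· + ·) φ ψ = (ofHom (op addMap φ.toHom ψ.toHom)).toFun := by
  funext p q
  refine opVal_eq _ addMap (fun x y => by simp [addMap]) ?_ φ ψ p q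
  intro x y a b c d ha hb hc hd
  refine bilin_mem (fun x y => x + y) ?_ ?_ x y a b c d ha hb hc hd
  · intro y a b s t h
    linear_combination (-y) * h
  · intro y a b s t h
    linear_combination (-y) * h

theorem opVal_mul (φ ψ : RL L) :
    opVal (· * ·) φ ψ = (ofHom (op mulMap φ.toHom ψ.toHom)).toFun := by
  funext p q
  refine opVal_eq _ mulMap (fun x y => by simp [mulMap]) ?_ φ ψ p q
  intro x y a b c d ha hb hc hd
  refine bilin_mem (fun x y => x * y) ?_ ?_ x y a b c d ha hb hc hd
  · intro y a b s t _
    ring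
  · intro y a b s t _
    ring

/-- `(φ + ψ)(p, q) = ⋁ {φ(r, s) ∧ ψ(t, u) | ⟨r, s⟩ + ⟨t, u⟩ ⊆ ⟨p, q⟩}` -/
instance : Add (RL L) where
  add φ ψ :=
    { toFun := opVal (· + ·) φ ψ
      inf_eq := by rw [opVal_add]; exact (ofHom _).inf_eq
      sup_eq := by rw [opVal_add]; exact (ofHom _).sup_eq
      eq_iSup := by rw [opVal_add]; exact (ofHom _).eq_iSup
      iSup_eq := by rw [opVal_add]; exact (ofHom _).iSup_eq }

/-- `(φ ψ)(p, q) = ⋁ {φ(r, s) ∧ ψ(t, u) | ⟨r, s⟩ · ⟨t, u⟩ ⊆ ⟨p, q⟩}` -/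
instance : Mul (RL L) where
  mul φ ψ :=
    { toFun := opVal (· * ·) φ ψ
      inf_eq := by rw [opVal_mul]; exact (ofHom _).inf_eq
      sup_eq := by rw [opVal_mul]; exact (ofHom _).sup_eq
      eq_iSup := by rw [opVal_mul]; exact (ofHom _).eq_iSup
      iSup_eq := by rw [opVal_mul]; exact (ofHom _).iSup_eq }

theorem toHom_add (φ ψ : RL L) : (φ + ψ).toHom = op addMap φ.toHom ψ.toHom := by
  have : φ + ψ = ofHom (op addMap φ.toHom ψ.toHom) := RL.ext (opVal_add φ ψ)
  rw [this, toHom_ofHom]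

theorem toHom_mul (φ ψ : RL L) : (φ * ψ).toHom = op mulMap φ.toHom ψ.toHom := by
  have : φ * ψ = ofHom (op mulMap φ.toHom ψ.toHom) := RL.ext (opVal_mul φ ψ)
  rw [this, toHom_ofHom]

/-- Negation on `ℝ` as a continuous map. -/
def negMap : C(ℝ, ℝ) := ⟨fun x => -x, by fun_prop⟩

theorem neg_aux (φ : RL L) :
    (fun p q => φ.toFun (-q) (-p)) = (ofHom (φ.toHom.comp (Opens.comap negMap))).toFun := by
  funext p q
  rw [← toHom_ival]
  change φ.toHom _ = φ.toHom _
  congr 1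
  apply Opens.ext
  ext x
  simp only [ival, Opens.coe_mk, Rat.cast_neg, Set.mem_Ioo]
  change _ ↔ (p : ℝ) < -x ∧ -x < q
  constructor <;> rintro ⟨h1, h2⟩ <;> constructor <;> linarith

/-- `(-φ)(p, q) = φ(-q, -p)` -/
instance : Neg (RL L) where
  neg φ :=
    { toFun := fun p q => φ.toFun (-q) (-p)
      inf_eq := by
        have h := (ofHom (φ.toHom.comp (Opens.comap negMap))).inf_eq
        rw [← neg_aux] at h
        exact h
      sup_eq := by
        have h := (ofHom (φ.toHom.comp (Opens.comap negMap))).sup_eq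
        rw [← neg_aux] at h
        exact h
      eq_iSup := by
        have h := (ofHom (φ.toHom.comp (Opens.comap negMap))).eq_iSup
        rw [← neg_aux] at h
        exact h
      iSup_eq := by
        have h := (ofHom (φ.toHom.comp (Opens.comap negMap))).iSup_eq
        rw [← neg_aux] at h
        exact h }

theorem toHom_neg (φ : RL L) : (-φ).toHom = φ.toHom.comp (Opens.comap negMap) := by
  have : -φ = ofHom (φ.toHom.comp (Opens.comap negMap)) := RL.ext (neg_aux φ)
  rw [this, toHom_ofHom]

/-- The homomorphism on `Opens ℝ` concentrated at the real number `x`. -/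
noncomputable def pointHom (x : ℝ) : FrameHom (Opens ℝ) L where
  toFun U := ⨆ (_ : x ∈ U), ⊤
  map_inf' U V := by
    by_cases h1 : x ∈ U <;> by_cases h2 : x ∈ V <;> simp [h1, h2]
  map_top' := by simp
  map_sSup' S := by
    apply le_antisymm
    · refine iSup_le fun h => ?_
      rw [Opens.mem_sSup] at h
      obtain ⟨U, hU, hx⟩ := h
      exact le_sSup_of_le ⟨U, hU, rfl⟩ (le_iSup_of_le hx le_rfl)
    · apply sSup_le
      rintro _ ⟨U, hU, rfl⟩
      exact iSup_le fun h => le_iSup_of_le (Opens.mem_sSup.2 ⟨U, hU, h⟩) le_rfl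

theorem const_aux (c : ℚ) :
    (fun p q => ⨆ (_ : p < c ∧ c < q), (⊤ : L)) = (ofHom (pointHom (c : ℝ))).toFun := by
  funext p q
  change _ = ⨆ (_ : (c : ℝ) ∈ ival p q), (⊤ : L)
  simp [mem_ival]

/-- The constant function with rational value `c`: it takes `(p, q)` to `1` if `p < c < q`, and to
`0` otherwise. -/
def const (c : ℚ) : RL L where
  toFun p q := ⨆ (_ : p < c ∧ c < q), ⊤
  inf_eq := by
    have h := (ofHom (pointHom (c : ℝ)) : RL L).inf_eq
    rw [← const_aux] at h
    exact h
  sup_eq := by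
    have h := (ofHom (pointHom (c : ℝ)) : RL L).sup_eq
    rw [← const_aux] at h
    exact h
  eq_iSup := by
    have h := (ofHom (pointHom (c : ℝ)) : RL L).eq_iSup
    rw [← const_aux] at h
    exact h
  iSup_eq := by
    have h := (ofHom (pointHom (c : ℝ)) : RL L).iSup_eq
    rw [← const_aux] at h
    exact h

instance : Zero (RL L) := ⟨const 0⟩

instance : One (RL L) := ⟨const 1⟩

theorem toHom_const (c : ℚ) {X : Type} [TopologicalSpace X] (T : FrameHom (Opens X) L) :
    (const c : RL L).toHom = T.comp (Opens.comap (ContinuousMap.const X (c : ℝ))) := by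
  have : (const c : RL L) = ofHom (pointHom (c : ℝ)) := RL.ext (const_aux c)
  rw [this, toHom_ofHom]
  ext U
  change (⨆ (_ : (c : ℝ) ∈ U), (⊤ : L)) = T (Opens.comap (ContinuousMap.const X (c : ℝ)) U)
  by_cases h : (c : ℝ) ∈ U
  · have : Opens.comap (ContinuousMap.const X (c : ℝ)) U = ⊤ := by
      apply Opens.ext
      ext x
      simp [h]
    rw [this, map_top]
    simp [h]
  · have : Opens.comap (ContinuousMap.const X (c : ℝ)) U = ⊥ := by
      apply Opens.ext
      ext x
      simp [h]
    rw [this, map_bot]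
    simp [h]

/-- The ring laws are inherited from those of `C(X, ℝ)`. -/
theorem lift_eq (φ ψ χ : RL L) :
    ∃ (T : FrameHom (Opens ((ℝ × ℝ) × ℝ)) L) (a b c : C((ℝ × ℝ) × ℝ, ℝ)),
      φ = ofHom (T.comp (Opens.comap a)) ∧ ψ = ofHom (T.comp (Opens.comap b)) ∧
        χ = ofHom (T.comp (Opens.comap c)) := by
  obtain ⟨T, a, b, c, h1, h2, h3⟩ := exists_common φ.toHom ψ.toHom χ.toHom
  exact ⟨T, a, b, c, by rw [← h1, ofHom_toHom], by rw [← h2, ofHom_toHom],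
    by rw [← h3, ofHom_toHom]⟩

section pull

variable {X : Type} [TopologicalSpace X] (T : FrameHom (Opens X) L) (a b : C(X, ℝ))

theorem pull_add : (ofHom (T.comp (Opens.comap a)) + ofHom (T.comp (Opens.comap b)) : RL L) =
    ofHom (T.comp (Opens.comap (a + b))) := by
  apply toHom_injective
  rw [toHom_add, toHom_ofHom, toHom_ofHom, toHom_ofHom, op_comap]
  rfl

theorem pull_mul : (ofHom (T.comp (Opens.comap a)) * ofHom (T.comp (Opens.comap b)) : RL L) =
    ofHom (T.comp (Opens.comap (a * b))) := by
  apply toHom_injective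
  rw [toHom_mul, toHom_ofHom, toHom_ofHom, toHom_ofHom, op_comap]
  rfl

theorem pull_neg : (-ofHom (T.comp (Opens.comap a)) : RL L) =
    ofHom (T.comp (Opens.comap (-a))) := by
  apply toHom_injective
  rw [toHom_neg, toHom_ofHom, toHom_ofHom]
  rfl

theorem pull_zero : (0 : RL L) = ofHom (T.comp (Opens.comap 0)) := by
  apply toHom_injective
  rw [toHom_ofHom]
  refine (toHom_const 0 T).trans ?_
  congr 2
  ext x
  simp

theorem pull_one : (1 : RL L) = ofHom (T.comp (Opens.comap 1)) := by
  apply toHom_injective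
  rw [toHom_ofHom]
  refine (toHom_const 1 T).trans ?_
  congr 2
  ext x
  simp

end pull

/-- The ring `ℛL` of real-valued continuous functions on the frame `L`. -/
instance : CommRing (RL L) where
  add_assoc φ ψ χ := by
    obtain ⟨T, a, b, c, rfl, rfl, rfl⟩ := lift_eq φ ψ χ
    simp only [pull_add, add_assoc]
  zero_add φ := by
    obtain ⟨T, a, b, c, rfl, -, -⟩ := lift_eq φ φ φ
    rw [pull_zero T, pull_add, zero_add]
  add_zero φ := by
    obtain ⟨T, a, b, c, rfl, -, -⟩ := lift_eq φ φ φ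
    rw [pull_zero T, pull_add, add_zero]
  add_comm φ ψ := by
    obtain ⟨T, a, b, c, rfl, rfl, -⟩ := lift_eq φ ψ φ
    rw [pull_add, pull_add, add_comm]
  neg_add_cancel φ := by
    obtain ⟨T, a, b, c, rfl, -, -⟩ := lift_eq φ φ φ
    rw [pull_zero T, pull_neg, pull_add, neg_add_cancel]
  mul_assoc φ ψ χ := by
    obtain ⟨T, a, b, c, rfl, rfl, rfl⟩ := lift_eq φ ψ χ
    simp only [pull_mul, mul_assoc]
  one_mul φ := by
    obtain ⟨T, a, b, c, rfl, -, -⟩ := lift_eq φ φ φ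
    rw [pull_one T, pull_mul, one_mul]
  mul_one φ := by
    obtain ⟨T, a, b, c, rfl, -, -⟩ := lift_eq φ φ φ
    rw [pull_one T, pull_mul, mul_one]
  mul_comm φ ψ := by
    obtain ⟨T, a, b, c, rfl, rfl, -⟩ := lift_eq φ ψ φ
    rw [pull_mul, pull_mul, mul_comm]
  left_distrib φ ψ χ := by
    obtain ⟨T, a, b, c, rfl, rfl, rfl⟩ := lift_eq φ ψ χ
    simp only [pull_mul, pull_add, mul_add]
  right_distrib φ ψ χ := by
    obtain ⟨T, a, b, c, rfl, rfl, rfl⟩ := lift_eq φ ψ χ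
    simp only [pull_mul, pull_add, add_mul]
  zero_mul φ := by
    obtain ⟨T, a, b, c, rfl, -, -⟩ := lift_eq φ φ φ
    rw [pull_zero T, pull_mul, zero_mul]
  mul_zero φ := by
    obtain ⟨T, a, b, c, rfl, -, -⟩ := lift_eq φ φ φ
    rw [pull_zero T, pull_mul, mul_zero]
  nsmul := nsmulRec
  zsmul := zsmulRec

end RL

/-! ### Cozero elements, `P_F`-frames and `d`-ideals -/

/-- The cozero element of `φ`: the join of all `φ(p, 0) ∨ φ(0, q)`. -/
def coz {L : Type u} [Order.Frame L] (φ : RL L) : L :=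
  ⨆ (p : ℚ) (q : ℚ), φ.toFun p 0 ⊔ φ.toFun 0 q

/-- The cozero part of `L`. -/
def Coz (L : Type u) [Order.Frame L] : Set L := Set.range (coz : RL L → L)

/-- `L` is a `P_F`-frame: of any two disjoint cozero elements, at least one is complemented. -/
def IsPFFrame (L : Type u) [Order.Frame L] : Prop :=
  ∀ a ∈ Coz L, ∀ b ∈ Coz L, a ⊓ b = ⊥ → IsComplemented a ∨ IsComplemented b

/-- `I` is a `d`-ideal of `ℛL`: if `f ∈ I` and `coz α ≤ (coz f)**`, then `α ∈ I`.  In a frame, `aᶜ`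
is the pseudocomplement of `a`. -/
def IsDIdeal {L : Type u} [Order.Frame L] (I : Ideal (RL L)) : Prop :=
  ∀ α : RL L, ∀ f ∈ I, coz α ≤ (coz f)ᶜᶜ → α ∈ I

end PointfreeReal

/-! Finitely many elements of `RL L` are pulled back from continuous functions on one space, so
identities, divisibility and cozero elements can be handled pointwise. Two constructions carry the
argument. Cube roots: `φ` and its cube root have the same cozero element, so a d-ideal containing
`φ` contains the root. If the root is `φ * υ`, even only after multiplying by `φ`, then `φ * (1 - φ
^ 2 * υ ^ 3) = 0` and `coz φ` is complemented (`isComplemented_coz_of_dvd`). This recovers `P_F`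
from the ideal conditions. For 3, apply it to the principal ideals of two disjoint elements, which
meet in the d-ideal `⊥`. For 1, enlarge the two principal ideals by annihilating d-ideals so that
their sum is a proper d-ideal. Minima: `μ = min (φ ^ 2) (ψ ^ 2)` is divisible by `φ` and by `ψ`, and
`φ ^ 2 - μ`, `ψ ^ 2 - μ` have product zero. In a `P_F`-frame one of their cozero elements is
complemented, so up to an idempotent multiple of one element, the square of that element is a
multiple of the other (`IsPFFrame.dominated`). Splitting along this idempotent gives the ideal
conditions. -/

namespace PointfreeReal

universe u

variable {L : Type u} [Order.Frame L]

/-! ### Pointwise calculus of cozero elements -/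

namespace RL

/-- The element of `ℛL` induced by a continuous function on a space `X` that `L` maps to. -/
def pull {X : Type} [TopologicalSpace X] (T : FrameHom (Opens X) L) (a : C(X, ℝ)) : RL L :=
  ofHom (T.comp (Opens.comap a))

section pull

variable {X : Type} [TopologicalSpace X] (T : FrameHom (Opens X) L) (a b : C(X, ℝ))

theorem pull_add' : pull T a + pull T b = pull T (a + b) := pull_add T a b

theorem pull_mul' : pull T a * pull T b = pull T (a * b) := pull_mul T a b

theorem pull_sub' : pull T a - pull T b = pull T (a - b) := by
  rw [sub_eq_add_neg, sub_eq_add_neg, ← pull_add' T a (-b)]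
  exact congrArg _ (pull_neg T b)

theorem pull_zero' : pull T 0 = 0 := (pull_zero T).symm

theorem pull_one' : pull T 1 = 1 := (pull_one T).symm

/-- The set where a continuous function does not vanish, as an open set. -/
def supp (a : C(X, ℝ)) : Opens X := ⟨{x | a x ≠ 0}, isOpen_ne_fun a.continuous continuous_const⟩

theorem mem_supp {a : C(X, ℝ)} {x : X} : x ∈ supp a ↔ a x ≠ 0 := Iff.rfl

/-- The rational intervals with an endpoint at 0 cover exactly the nonzero reals, and `T` and
preimages preserve joins. -/
theorem coz_pull : coz (pull T a) = T (supp a) := by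
  have h : (⨆ (p : ℚ) (q : ℚ), (ival p 0 ⊔ ival 0 q)) = supp (ContinuousMap.id ℝ) := by
    ext x
    constructor
    · intro hx
      simp only [SetLike.mem_coe, Opens.mem_iSup] at hx
      obtain ⟨p, q, h | h⟩ := hx
      · exact (show x < 0 by simpa using h.2).ne
      · exact (show 0 < x by simpa using h.1).ne'
    · intro hx
      simp only [SetLike.mem_coe, Opens.mem_iSup]
      rcases lt_or_gt_of_ne (show x ≠ 0 from hx) with hx | hx
      · obtain ⟨p, hp⟩ := exists_rat_lt x
        exact ⟨p, 0, Or.inl ⟨hp, by simpa using hx⟩⟩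
      · obtain ⟨q, hq⟩ := exists_rat_gt x
        exact ⟨0, q, Or.inr ⟨by simpa using hx, hq⟩⟩
  have h2 : coz (pull T a) = (T.comp (Opens.comap a))
      (⨆ (p : ℚ) (q : ℚ), (ival p 0 ⊔ ival 0 q)) := by
    simp only [map_iSup, map_sup]
    rfl
  rw [h2, h]
  rfl

end pull

theorem exists_pull (φ ψ : RL L) : ∃ (T : FrameHom (Opens ((ℝ × ℝ) × ℝ)) L)
    (a b : C((ℝ × ℝ) × ℝ, ℝ)), φ = pull T a ∧ ψ = pull T b := by
  obtain ⟨T, a, b, -, h1, h2, -⟩ := lift_eq φ ψ ψ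
  exact ⟨T, a, b, h1, h2⟩

theorem coz_mul (φ ψ : RL L) : coz (φ * ψ) = coz φ ⊓ coz ψ := by
  obtain ⟨T, a, b, rfl, rfl⟩ := exists_pull φ ψ
  rw [pull_mul', coz_pull, coz_pull, coz_pull, ← map_inf]
  congr 1
  ext x
  exact mul_ne_zero_iff

theorem coz_add_le (φ ψ : RL L) : coz (φ + ψ) ≤ coz φ ⊔ coz ψ := by
  obtain ⟨T, a, b, rfl, rfl⟩ := exists_pull φ ψ
  rw [pull_add', coz_pull, coz_pull, coz_pull, ← map_sup]
  refine OrderHomClass.mono T fun x hx => ?_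
  by_contra h
  have h' : ¬ (a x ≠ 0 ∨ b x ≠ 0) := h
  push Not at h'
  exact hx (by simp [h'])

theorem coz_zero : coz (0 : RL L) = ⊥ := by
  obtain ⟨T, -⟩ := exists_pull (0 : RL L) 0
  rw [← pull_zero' T, coz_pull, ← map_bot T]
  congr 1
  ext x
  simp [mem_supp]

theorem coz_one : coz (1 : RL L) = ⊤ := by
  obtain ⟨T, -⟩ := exists_pull (0 : RL L) 0
  rw [← pull_one' T, coz_pull, ← map_top T]
  congr 1
  ext x
  simp [mem_supp]

theorem coz_pow (φ : RL L) {n : ℕ} (hn : n ≠ 0) : coz (φ ^ n) = coz φ := by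
  induction n with
  | zero => exact absurd rfl hn
  | succ n ih =>
    rcases eq_or_ne n 0 with rfl | h
    · simp
    · rw [pow_succ, coz_mul, ih h, inf_idem]

theorem coz_le_of_dvd {φ ψ : RL L} (h : φ ∣ ψ) : coz ψ ≤ coz φ := by
  obtain ⟨χ, rfl⟩ := h
  rw [coz_mul]
  exact inf_le_left

theorem eq_zero_of_coz_eq_bot {φ : RL L} (h : coz φ = ⊥) : φ = 0 := by
  obtain ⟨T, a, -, rfl, -⟩ := exists_pull φ φ
  rw [coz_pull] at h
  rw [← pull_zero' T]
  -- Since `T` kills `supp a`, the value `T U` depends only on the trace of `U` on the zero set of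
  -- `a`, where `a` and 0 have the same preimages.
  have key : ∀ U : Opens ((ℝ × ℝ) × ℝ), ∀ V, (∀ x, a x = 0 → x ∈ U → x ∈ V) → T U ≤ T V := by
    intro U V hUV
    rw [← sup_bot_eq (T V), ← h, ← map_sup]
    refine OrderHomClass.mono T fun x hx => ?_
    by_cases ha : a x = 0
    · exact Or.inl (hUV x ha hx)
    · exact Or.inr ha
  apply RL.ext
  funext p q
  apply le_antisymm
  · refine key _ _ fun x ha hx => ?_
    change (0 : ℝ) ∈ ival p q
    rw [← ha]
    exact hx
  · refine key _ _ fun x ha hx => ?_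
    change a x ∈ ival p q
    rw [ha]
    exact hx

/-! ### Units, cube roots, minima and separation -/

section restrict

variable {X : Type} [TopologicalSpace X] (T : FrameHom (Opens X) L) (W : Opens X)

/-- An open subset of an open subspace, as an open subset of the ambient space. -/
def extend (V : Opens W) : Opens X :=
  ⟨(↑) '' (V : Set W), W.isOpen.isOpenMap_subtype_val _ V.isOpen⟩

/-- A homomorphism on the open sets of `X` that sends the open set `W` to the top element
restricts to a homomorphism on the open sets of `W`. -/
def restrict (hW : T W = ⊤) : FrameHom (Opens W) L where
  toFun V := T (extend W V)
  map_inf' U V := by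
    rw [← map_inf]
    congr 1
    exact Opens.ext (Set.image_inter Subtype.val_injective)
  map_top' := by
    rw [← hW]
    congr 1
    ext x
    simp [extend]
  map_sSup' S := by
    rw [← Set.image_image T, ← map_sSup]
    congr 1
    ext x
    simp only [extend, Opens.coe_mk, Opens.coe_sSup, Set.image_iUnion, Set.mem_iUnion,
      Set.biUnion_image]

theorem pull_restrict (hW : T W = ⊤) (a : C(X, ℝ)) :
    pull (restrict T W hW) (a.comp ⟨Subtype.val, continuous_subtype_val⟩) = pull T a := by
  apply RL.ext
  funext p q
  change T (extend W _) = T (Opens.comap a (ival p q))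
  rw [← inf_top_eq (T (Opens.comap a (ival p q))), ← hW, ← map_inf]
  congr 1
  ext x
  constructor
  · rintro ⟨y, hy, rfl⟩
    exact ⟨hy, y.2⟩
  · rintro ⟨h1, h2⟩
    exact ⟨⟨x, h2⟩, h1, rfl⟩

end restrict

/-- `T` factors through the open subspace `supp a`, on which `1 / a` is continuous. -/
theorem isUnit_of_coz_eq_top {φ : RL L} (h : coz φ = ⊤) : IsUnit φ := by
  obtain ⟨T, a, -, rfl, -⟩ := exists_pull φ φ
  rw [coz_pull] at h
  rw [← pull_restrict T _ h a]
  refine IsUnit.of_mul_eq_one (pull (restrict T _ h) ⟨fun x : supp a => (a x)⁻¹,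
    Continuous.inv₀ (a.continuous.comp continuous_subtype_val) fun x => x.2⟩) ?_
  rw [pull_mul', ← pull_one' (restrict T _ h)]
  congr 1
  ext x
  exact mul_inv_cancel₀ x.2

/-- Cubing is an order isomorphism, hence a homeomorphism, of `ℝ`. An odd exponent avoids any
assumption on the sign of `φ`. -/
theorem exists_cube_root (φ : RL L) : ∃ ψ : RL L, ψ ^ 3 = φ := by
  obtain ⟨T, a, -, rfl, -⟩ := exists_pull φ φ
  have h3 : Odd 3 := by decide
  have hsurj : Function.Surjective fun x : ℝ => x ^ 3 :=
    (continuous_pow 3).surjective (Filter.tendsto_pow_atTop (by norm_num)) (by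
      refine Filter.tendsto_neg_atTop_iff.1 ?_
      refine ((Filter.tendsto_pow_atTop (α := ℝ) (n := 3) (by norm_num)).comp
        Filter.tendsto_neg_atBot_atTop).congr fun x => ?_
      exact h3.neg_pow x)
  let r : ℝ ≃o ℝ := StrictMono.orderIsoOfSurjective _ h3.strictMono_pow hsurj
  refine ⟨pull T ⟨fun x => r.symm (a x), r.symm.continuous.comp a.continuous⟩, ?_⟩
  rw [pow_three, pull_mul', pull_mul']
  congr 1
  ext x
  exact (pow_three _).symm.trans (r.apply_symm_apply (a x))

/-- The squares of `φ` and `ψ` have a minimum, divisible by both `φ` and `ψ`. -/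
theorem exists_min_sq (φ ψ : RL L) :
    ∃ μ : RL L, φ ∣ μ ∧ ψ ∣ μ ∧ (φ ^ 2 - μ) * (ψ ^ 2 - μ) = 0 := by
  obtain ⟨T, a, b, rfl, rfl⟩ := exists_pull φ ψ
  -- This is the cofactor of `p.2` in the minimum of the squares. Division by zero gives 0 at the
  -- origin, which is the continuous extension because of the bound by `|p.2|`.
  have hc : Continuous fun p : ℝ × ℝ => p.1 ^ 2 * p.2 / max (p.1 ^ 2) (p.2 ^ 2) := by
    have hbound : ∀ p : ℝ × ℝ, |p.1 ^ 2 * p.2 / max (p.1 ^ 2) (p.2 ^ 2)| ≤ |p.2| := by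
      intro p
      rw [abs_div, abs_mul, abs_of_nonneg (sq_nonneg p.1), abs_of_nonneg (a := max _ _)
        (le_max_of_le_left (sq_nonneg p.1))]
      refine div_le_of_le_mul₀ (le_max_of_le_left (sq_nonneg p.1)) (abs_nonneg _) ?_
      rw [mul_comm]
      exact mul_le_mul_of_nonneg_left (le_max_left _ _) (abs_nonneg _)
    rw [continuous_iff_continuousAt]
    rintro ⟨x, y⟩
    by_cases h : max (x ^ 2) (y ^ 2) = 0
    · have hy : y = 0 := by
        have := le_max_right (x ^ 2) (y ^ 2)
        rw [h] at this
        exact pow_eq_zero_iff two_ne_zero |>.1 (le_antisymm this (sq_nonneg y))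
      subst hy
      rw [ContinuousAt, h, div_zero]
      refine squeeze_zero_norm hbound ?_
      have : Continuous fun p : ℝ × ℝ => |p.2| := by fun_prop
      simpa using this.tendsto (x, (0 : ℝ))
    · exact ContinuousAt.div (by fun_prop) (by fun_prop) h
  have hmin : ∀ x y : ℝ, min (x ^ 2) (y ^ 2) = x ^ 2 * y ^ 2 / max (x ^ 2) (y ^ 2) := by
    intro x y
    by_cases h : max (x ^ 2) (y ^ 2) = 0
    · rw [h, div_zero]
      exact le_antisymm (h ▸ min_le_max) (le_min (sq_nonneg x) (sq_nonneg y))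
    · rw [eq_div_iff h, min_mul_max]
  refine ⟨pull T ⟨fun x => min (a x ^ 2) (b x ^ 2), by fun_prop⟩,
    ⟨pull T ⟨fun x => b x ^ 2 * a x / max (b x ^ 2) (a x ^ 2),
      hc.comp (b.continuous.prodMk a.continuous)⟩, ?_⟩,
    ⟨pull T ⟨fun x => a x ^ 2 * b x / max (a x ^ 2) (b x ^ 2),
      hc.comp (a.continuous.prodMk b.continuous)⟩, ?_⟩, ?_⟩
  · rw [pull_mul']
    congr 1
    ext x
    change min (a x ^ 2) (b x ^ 2) = a x * (b x ^ 2 * a x / max (b x ^ 2) (a x ^ 2))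
    rw [hmin, max_comm]
    ring
  · rw [pull_mul']
    congr 1
    ext x
    change min (a x ^ 2) (b x ^ 2) = b x * (a x ^ 2 * b x / max (a x ^ 2) (b x ^ 2))
    rw [hmin]
    ring
  · rw [pow_two, pow_two, pull_mul', pull_mul', pull_sub', pull_sub', pull_mul', ← pull_zero' T]
    congr 1
    ext x
    rcases le_total (a x ^ 2) (b x ^ 2) with h | h
    · simp [← pow_two, min_eq_left h]
    · simp [← pow_two, min_eq_right h]

/-- A nonzero `φ` is bounded away from zero on some nonzero cozero element. -/
theorem exists_separation {φ : RL L} (h : φ ≠ 0) :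
    ∃ η κ : RL L, η ≠ 0 ∧ η * κ = 0 ∧ coz η ≤ coz φ ∧ coz φ ⊔ coz κ = ⊤ := by
  obtain ⟨T, a, -, rfl, -⟩ := exists_pull φ φ
  -- The sets `a ^ 2 > 1 / (n + 1)` exhaust `supp a`, so `T` cannot kill all of them. The positive
  -- and negative parts of `a ^ 2 - 1 / (n + 1)` then serve as `η` and `κ`.
  have hex : ∃ n : ℕ, T (supp ⟨fun x => max (a x ^ 2 - 1 / ((n : ℝ) + 1)) 0, by fun_prop⟩) ≠ ⊥ := by
    by_contra! hn
    refine h (eq_zero_of_coz_eq_bot ?_)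
    rw [coz_pull, eq_bot_iff]
    have hle : supp a ≤ ⨆ n : ℕ, supp ⟨fun x => max (a x ^ 2 - 1 / ((n : ℝ) + 1)) 0,
        by fun_prop⟩ := by
      intro x hx
      obtain ⟨n, hn⟩ := exists_nat_one_div_lt (show 0 < a x ^ 2 from pow_two_pos_of_ne_zero hx)
      exact Opens.mem_iSup.2 ⟨n, (lt_max_of_lt_left (sub_pos.2 hn)).ne'⟩
    refine (OrderHomClass.mono T hle).trans ?_
    rw [map_iSup]
    exact iSup_le fun n => (hn n).le
  obtain ⟨n, hn⟩ := hex
  have hpos : (0 : ℝ) < 1 / ((n : ℝ) + 1) := by positivity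
  refine ⟨pull T ⟨fun x => max (a x ^ 2 - 1 / ((n : ℝ) + 1)) 0, by fun_prop⟩,
    pull T ⟨fun x => max (1 / ((n : ℝ) + 1) - a x ^ 2) 0, by fun_prop⟩, ?_, ?_, ?_, ?_⟩
  · intro h0
    rw [← coz_pull, h0, coz_zero] at hn
    exact hn rfl
  · rw [pull_mul', ← pull_zero' T]
    congr 1
    ext x
    change max _ 0 * max _ 0 = (0 : ℝ)
    rcases le_total (a x ^ 2) (1 / ((n : ℝ) + 1)) with h | h
    · rw [max_eq_right (sub_nonpos.2 h), zero_mul]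
    · rw [max_eq_right (a := 1 / ((n : ℝ) + 1) - a x ^ 2) (sub_nonpos.2 h), mul_zero]
  · rw [coz_pull, coz_pull]
    refine OrderHomClass.mono T fun x hx ha => hx ?_
    change max (a x ^ 2 - 1 / ((n : ℝ) + 1)) 0 = 0
    rw [ha]
    exact max_eq_right (by linarith)
  · rw [coz_pull, coz_pull, ← map_sup, ← map_top T]
    congr 1
    ext x
    refine ⟨fun _ => trivial, fun _ => ?_⟩
    by_cases ha : a x = 0
    · refine Or.inr (ne_of_gt (lt_max_of_lt_left ?_))
      rw [ha]
      linarith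
    · exact Or.inl ha

/-! ### Idempotents and division -/

/-- A complemented element is the cozero element of an idempotent. -/
theorem exists_idempotent {c : L} (hc : IsComplemented c) :
    ∃ ε : RL L, ε * ε = ε ∧ coz ε = c := by
  obtain ⟨d, hcd⟩ := hc
  -- A complementary pair amounts to a homomorphism on the open sets of the discrete two-point
  -- space; `ε` is the indicator of `true`.
  let T : FrameHom (Opens Bool) L :=
    { toFun := fun U => (⨆ _ : true ∈ U, c) ⊔ ⨆ _ : false ∈ U, d
      map_inf' := by
        intro U V
        by_cases h1 : true ∈ U <;> by_cases h2 : false ∈ U <;> by_cases h3 : true ∈ V <;>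
          by_cases h4 : false ∈ V <;>
          simp [h1, h2, h3, h4, hcd.inf_eq_bot, hcd.symm.inf_eq_bot, hcd.sup_eq_top]
      map_top' := by simp [hcd.sup_eq_top]
      map_sSup' := by
        intro S
        apply le_antisymm
        · apply sup_le
          · refine iSup_le fun h => ?_
            obtain ⟨U, hU, hx⟩ := Opens.mem_sSup.1 h
            exact le_sSup_of_le ⟨U, hU, rfl⟩ (le_sup_of_le_left (le_iSup_of_le hx le_rfl))
          · refine iSup_le fun h => ?_
            obtain ⟨U, hU, hx⟩ := Opens.mem_sSup.1 h
            exact le_sSup_of_le ⟨U, hU, rfl⟩ (le_sup_of_le_right (le_iSup_of_le hx le_rfl))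
        · apply sSup_le
          rintro _ ⟨U, hU, rfl⟩
          exact sup_le_sup (iSup_mono' fun h => ⟨Opens.mem_sSup.2 ⟨U, hU, h⟩, le_rfl⟩)
            (iSup_mono' fun h => ⟨Opens.mem_sSup.2 ⟨U, hU, h⟩, le_rfl⟩) }
  refine ⟨pull T ⟨fun x => if x then 1 else 0, continuous_of_discreteTopology⟩, ?_, ?_⟩
  · rw [pull_mul']
    congr 1
    ext x
    cases x <;> simp
  · rw [coz_pull]
    change (⨆ _ : true ∈ supp _, c) ⊔ (⨆ _ : false ∈ supp _, d) = c
    simp [mem_supp]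

theorem mul_eq_zero_iff {φ ψ : RL L} : φ * ψ = 0 ↔ coz φ ⊓ coz ψ = ⊥ := by
  rw [← coz_mul]
  exact ⟨fun h => by rw [h, coz_zero], eq_zero_of_coz_eq_bot⟩

theorem isCompl_coz {ε : RL L} (h : ε * ε = ε) : IsCompl (coz ε) (coz (1 - ε)) := by
  refine IsCompl.of_eq (mul_eq_zero_iff.1 (by linear_combination -h)) ?_
  rw [eq_top_iff, ← coz_one]
  refine le_of_eq_of_le ?_ (coz_add_le ε (1 - ε))
  rw [add_sub_cancel]

/-- On a complemented element below `coz φ`, `φ` is invertible. -/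
theorem dvd_of_coz_le {φ ψ : RL L} {c : L} (hc : IsComplemented c) (hφ : c ≤ coz φ)
    (hψ : coz ψ ≤ c) : φ ∣ ψ := by
  obtain ⟨ε, hε, rfl⟩ := exists_idempotent hc
  -- This element agrees with `φ` on `coz ε` and with 1 on the complement.
  have hu : IsUnit (φ * ε + (1 - ε)) := by
    apply isUnit_of_coz_eq_top
    rw [eq_top_iff, ← (isCompl_coz hε).sup_eq_top]
    apply sup_le
    · have : coz ε = coz (φ * ε) := by rw [coz_mul, inf_eq_right.2 hφ]
      rw [this]
      exact coz_le_of_dvd ⟨ε, by linear_combination (1 - φ) * hε⟩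
    · exact coz_le_of_dvd ⟨1 - ε, by linear_combination (φ - 1) * hε⟩
  obtain ⟨υ, hυ⟩ := hu.exists_right_inv
  have hψε : ψ * (1 - ε) = 0 :=
    mul_eq_zero_iff.2 ((isCompl_coz hε).disjoint.mono_left hψ).eq_bot
  exact ⟨ψ * ε * υ, by linear_combination υ * hψε - ψ * hυ⟩

/-- Cubing `h` gives `φ ^ 4 = φ ^ 6 * υ ^ 3`, and powers do not change cozero elements, so `φ`
annihilates `1 - φ ^ 2 * υ ^ 3`. The factor `φ` in `h` admits roots of the form `φ * υ + y` with `φ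
* y = 0`. -/
theorem isComplemented_coz_of_dvd {φ ψ υ : RL L} (hψ : ψ ^ 3 = φ) (h : φ * ψ = φ ^ 2 * υ) :
    IsComplemented (coz φ) := by
  have h0 : φ * (1 - φ ^ 2 * υ ^ 3) = 0 := by
    have : coz (φ * (1 - φ ^ 2 * υ ^ 3)) = coz (φ ^ 4 * (1 - φ ^ 2 * υ ^ 3)) := by
      rw [coz_mul, coz_mul, coz_pow _ (by norm_num)]
    apply eq_zero_of_coz_eq_bot
    have h3 : φ ^ 4 * (1 - φ ^ 2 * υ ^ 3) = 0 := by
      have := congrArg (· ^ 3) h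
      simp only [mul_pow, hψ] at this
      linear_combination this
    rw [this, h3, coz_zero]
  refine ⟨coz (1 - φ ^ 2 * υ ^ 3), IsCompl.of_eq (mul_eq_zero_iff.1 h0) ?_⟩
  rw [eq_top_iff, ← coz_one]
  refine le_trans (le_of_eq_of_le ?_ (coz_add_le (φ ^ 2 * υ ^ 3) (1 - φ ^ 2 * υ ^ 3)))
    (sup_le_sup_right (coz_le_of_dvd ⟨φ * υ ^ 3, by ring⟩) _)
  rw [add_sub_cancel]

/-! ### Comparison of two elements -/

/-- Up to an idempotent on which `φ` is invertible, `φ ^ 2` is a multiple of `ψ`. -/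
def Dominated (φ ψ : RL L) : Prop :=
  ∃ ε : RL L, ε * ε = ε ∧ φ ∣ ε ∧ ψ ∣ (1 - ε) * φ ^ 2

/-- Let `ε` be the idempotent on `coz (φ ^ 2 - μ)`. Since `φ` divides `φ ^ 2 - μ`, it is invertible
there; off it, `φ ^ 2` equals `μ`, a multiple of `ψ`. -/
theorem dominated_of_isComplemented {φ ψ μ : RL L} (hφ : φ ∣ μ) (hψ : ψ ∣ μ)
    (hc : IsComplemented (coz (φ ^ 2 - μ))) : Dominated φ ψ := by
  obtain ⟨ε, hε, hcoz⟩ := exists_idempotent hc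
  refine ⟨ε, hε, ?_, ?_⟩
  · exact dvd_of_coz_le hc (coz_le_of_dvd (dvd_sub (dvd_pow_self φ two_ne_zero) hφ)) hcoz.le
  · have h : (φ ^ 2 - μ) * (1 - ε) = 0 := by
      rw [mul_eq_zero_iff, ← hcoz]
      exact (isCompl_coz hε).inf_eq_bot
    have : (1 - ε) * φ ^ 2 = μ * (1 - ε) := by linear_combination h
    rw [this]
    exact hψ.mul_right _

/-! ### Basic facts on d-ideals -/

/-- The elements whose cozero element is disjoint from `a`. -/
def disjointIdeal (a : L) : Ideal (RL L) where
  carrier := {φ | coz φ ≤ aᶜ}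
  add_mem' h1 h2 := (coz_add_le _ _).trans (sup_le h1 h2)
  zero_mem' := by simp [coz_zero]
  smul_mem' c φ h := (coz_le_of_dvd (Dvd.intro_left c rfl)).trans h

theorem mem_disjointIdeal {a : L} {φ : RL L} : φ ∈ disjointIdeal a ↔ coz φ ≤ aᶜ := Iff.rfl

/-- Double pseudocomplementation preserves binary meets. This localises the d-ideal condition to an
idempotent. -/
theorem coz_mul_le_compl_compl {α φ : RL L} (h : coz α ≤ (coz φ)ᶜᶜ) (ψ : RL L) :
    coz (α * ψ) ≤ (coz (φ * ψ))ᶜᶜ := by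
  rw [coz_mul, coz_mul, compl_compl_inf_distrib]
  exact inf_le_inf h le_compl_compl

end RL

open RL

theorem isDIdeal_disjointIdeal (a : L) : IsDIdeal (disjointIdeal a) := by
  intro α φ hφ h
  refine h.trans ?_
  rw [← compl_compl_compl a]
  exact compl_le_compl (compl_le_compl hφ)

theorem IsDIdeal.mem_of_dvd_pow {I : Ideal (RL L)} (hI : IsDIdeal I) {φ ψ : RL L} (hφ : φ ∈ I)
    {n : ℕ} (hn : n ≠ 0) (h : ψ ^ n = φ) : ψ ∈ I := by
  refine hI ψ φ hφ ?_
  rw [← h, coz_pow _ hn]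
  exact le_compl_compl

theorem exists_of_not_isDIdeal {I : Ideal (RL L)} (hI : ¬ IsDIdeal I) :
    ∃ α, ∃ φ ∈ I, coz α ≤ (coz φ)ᶜᶜ ∧ α ∉ I := by
  simpa [IsDIdeal] using hI

/-- A complemented element equals its double pseudocomplement, so `φ` divides `α`. -/
theorem mem_of_isComplemented_coz {I : Ideal (RL L)} {α φ : RL L} (hφ : φ ∈ I)
    (h : coz α ≤ (coz φ)ᶜᶜ) (hc : IsComplemented (coz φ)) : α ∈ I := by
  refine I.mem_of_dvd (dvd_of_coz_le hc le_rfl ?_) hφ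
  obtain ⟨d, hd⟩ := hc
  rwa [hd.compl_eq, hd.symm.compl_eq] at h

/-! ### From `P_F` to the ideal conditions -/

theorem IsPFFrame.dominated (hL : IsPFFrame L) (φ ψ : RL L) :
    Dominated φ ψ ∨ Dominated ψ φ := by
  obtain ⟨μ, hφ, hψ, h0⟩ := exists_min_sq φ ψ
  exact (hL _ ⟨_, rfl⟩ _ ⟨_, rfl⟩ (mul_eq_zero_iff.1 h0)).imp
    (dominated_of_isComplemented hφ hψ) (dominated_of_isComplemented hψ hφ)

theorem IsPFFrame.isDIdeal_or_of_inf (hL : IsPFFrame L) {I J : Ideal (RL L)}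
    (hIJ : IsDIdeal (I ⊓ J)) : IsDIdeal I ∨ IsDIdeal J := by
  have key : ∀ {I J : Ideal (RL L)}, IsDIdeal (I ⊓ J) → ∀ {α φ ψ : RL L}, φ ∈ I → ψ ∈ J →
      coz α ≤ (coz φ)ᶜᶜ → Dominated φ ψ → α ∈ I := by
    rintro I J hIJ α φ ψ hφ hψ h ⟨ε, hε, h1, h2⟩
    have hα : α = α * ε + α * (1 - ε) := by ring
    rw [hα]
    refine I.add_mem (I.mul_mem_left _ (I.mem_of_dvd h1 hφ)) ?_
    -- This element lies in both ideals and has the same cozero element as `φ * (1 - ε)`, so it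
    -- captures `α * (1 - ε)`.
    have hmem : (1 - ε) * φ ^ 2 ∈ I ⊓ J :=
      ⟨I.mem_of_dvd ⟨(1 - ε) * φ, by ring⟩ hφ, J.mem_of_dvd h2 hψ⟩
    refine (hIJ _ _ hmem ?_).1
    have : coz ((1 - ε) * φ ^ 2) = coz (φ * (1 - ε)) := by
      rw [coz_mul, coz_mul, coz_pow _ two_ne_zero, inf_comm]
    rw [this]
    exact coz_mul_le_compl_compl h _
  by_contra! hn
  obtain ⟨α, φ, hφ, hα, hαI⟩ := exists_of_not_isDIdeal hn.1
  obtain ⟨β, ψ, hψ, hβ, hβJ⟩ := exists_of_not_isDIdeal hn.2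
  rcases hL.dominated φ ψ with h | h
  · exact hαI (key hIJ hφ hψ hα h)
  · exact hβJ (key (inf_comm I J ▸ hIJ) hψ hφ hβ h)

theorem IsPFFrame.isDIdeal_add (hL : IsPFFrame L) {I J : Ideal (RL L)} (hI : IsDIdeal I)
    (hJ : IsDIdeal J) : IsDIdeal (I + J) := by
  have key : ∀ {I J : Ideal (RL L)}, IsDIdeal J → ∀ {α φ ψ : RL L}, φ ∈ I → ψ ∈ J →
      coz α ≤ (coz (φ + ψ))ᶜᶜ → Dominated φ ψ → α ∈ I + J := by
    rintro I J hJ α φ ψ hφ hψ h ⟨ε, hε, h1, h2⟩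
    have hα : α = α * ε + α * (1 - ε) := by ring
    rw [hα]
    -- Off `ε`, `coz φ` lies below `coz ψ`, so `φ + ψ` may be replaced by `ψ` and the d-ideal `J`
    -- takes the second summand.
    refine Submodule.add_mem_sup (I.mul_mem_left _ (I.mem_of_dvd h1 hφ)) (hJ _ _ hψ ?_)
    refine (coz_mul_le_compl_compl h (1 - ε)).trans (compl_le_compl (compl_le_compl ?_))
    rw [add_mul]
    refine (coz_add_le _ _).trans (sup_le ?_ (coz_le_of_dvd ⟨_, rfl⟩))
    have : coz (φ * (1 - ε)) = coz ((1 - ε) * φ ^ 2) := by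
      rw [coz_mul, coz_mul, coz_pow _ two_ne_zero, inf_comm]
    rw [this]
    exact coz_le_of_dvd h2
  intro α χ hχ h
  obtain ⟨φ, hφ, ψ, hψ, rfl⟩ := Submodule.mem_sup.1 hχ
  rcases hL.dominated φ ψ with hd | hd
  · exact key hJ hφ hψ h hd
  · rw [add_comm]
    exact key hI hψ hφ (add_comm φ ψ ▸ h) hd

theorem IsPFFrame.isDIdeal_or_of_add (hL : IsPFFrame L) {I J : Ideal (RL L)}
    (hIJ : IsDIdeal (I + J)) : IsDIdeal I ∨ IsDIdeal J := by
  have key : ∀ {I J : Ideal (RL L)} {α φ β ψ ι ι' κ κ' : RL L}, φ ∈ I → coz α ≤ (coz φ)ᶜᶜ →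
      ψ ∈ J → coz β ≤ (coz ψ)ᶜᶜ → ι ∈ I → κ ∈ J → ι' ∈ I → κ' ∈ J → (ι + κ) ^ 3 = α →
      (ι' + κ') ^ 3 = β → Dominated ι' κ → α ∈ I ∨ β ∈ J := by
    rintro I J α φ β ψ ι ι' κ κ' hφ hα hψ hβ hι hκ hι' hκ' rfl rfl ⟨ε, hε, h1, h2⟩
    have hεI : ε ∈ I := I.mem_of_dvd h1 hι'
    have hsplit : ∀ χ : RL L, χ = χ * ε + χ * (1 - ε) := fun χ => by ring
    have hdisj : coz (φ * (1 - ε)) ⊓ coz (ψ * ε) = ⊥ :=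
      mul_eq_zero_iff.1 (by linear_combination -φ * ψ * hε)
    -- `P_F` is used a second time: either `α` is settled off `ε`, with `ε ∈ I` covering the rest,
    -- or `β` is settled on `ε`.
    rcases hL _ ⟨_, rfl⟩ _ ⟨_, rfl⟩ hdisj with hc | hc
    · left
      rw [hsplit ((ι + κ) ^ 3)]
      exact I.add_mem (I.mul_mem_left _ hεI) (mem_of_isComplemented_coz (I.mul_mem_right _ hφ)
        (coz_mul_le_compl_compl hα _) hc)
    · right
      rw [hsplit ((ι' + κ') ^ 3)]
      refine J.add_mem (mem_of_isComplemented_coz (J.mul_mem_right _ hψ)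
        (coz_mul_le_compl_compl hβ _) hc) ?_
      -- In the cube, the only term without a factor `κ'` contains `ι' ^ 2`, which is a multiple of
      -- `κ ∈ J` off `ε`.
      have : (ι' + κ') ^ 3 * (1 - ε) = ι' * ((1 - ε) * ι' ^ 2) +
          (1 - ε) * (3 * ι' ^ 2 + 3 * ι' * κ' + κ' ^ 2) * κ' := by ring
      rw [this]
      exact J.add_mem (J.mul_mem_left _ (J.mem_of_dvd h2 hκ)) (J.mul_mem_left _ hκ')
  by_contra! hn
  obtain ⟨α, φ, hφ, hα, hαI⟩ := exists_of_not_isDIdeal hn.1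
  obtain ⟨β, ψ, hψ, hβ, hβJ⟩ := exists_of_not_isDIdeal hn.2
  obtain ⟨ρ, hρ⟩ := exists_cube_root α
  obtain ⟨σ, hσ⟩ := exists_cube_root β
  have hρ' : ρ ∈ I + J := (hIJ.mem_of_dvd_pow
    (hIJ α φ (Submodule.mem_sup_left hφ) hα) three_ne_zero hρ)
  have hσ' : σ ∈ I + J := (hIJ.mem_of_dvd_pow
    (hIJ β ψ (Submodule.mem_sup_right hψ) hβ) three_ne_zero hσ)
  obtain ⟨ι, hι, κ, hκ, rfl⟩ := Submodule.mem_sup.1 hρ'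
  obtain ⟨ι', hι', κ', hκ', rfl⟩ := Submodule.mem_sup.1 hσ'
  -- The `I`-part of one root is compared with the `J`-part of the other, so that both outcomes are
  -- symmetric under exchanging `I` and `J`.
  rcases hL.dominated ι' κ with h | h
  · exact (key hφ hα hψ hβ hι hκ hι' hκ' hρ hσ h).elim hαI hβJ
  · exact (key hψ hβ hφ hα hκ' hι' hκ hι (add_comm ι' κ' ▸ hσ) (add_comm ι κ ▸ hρ) h).elim hβJ hαI

/-! ### From the ideal conditions to `P_F` -/

theorem isPFFrame_of_inf (h : ∀ I J : Ideal (RL L), IsDIdeal (I ⊓ J) → IsDIdeal I ∨ IsDIdeal J) :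
    IsPFFrame L := by
  have key : ∀ φ : RL L, IsDIdeal (Ideal.span {φ}) → IsComplemented (coz φ) := by
    intro φ hφ
    obtain ⟨ψ, hψ⟩ := exists_cube_root φ
    obtain ⟨υ, hυ⟩ := Ideal.mem_span_singleton.1
      (hφ.mem_of_dvd_pow (Ideal.mem_span_singleton_self φ) three_ne_zero hψ)
    exact isComplemented_coz_of_dvd (υ := υ) hψ (by linear_combination φ * hυ)
  rintro _ ⟨φ, rfl⟩ _ ⟨ψ, rfl⟩ hφψ
  have hinf : Ideal.span {φ} ⊓ Ideal.span {ψ} = (⊥ : Ideal (RL L)) := by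
    rw [eq_bot_iff]
    rintro χ ⟨h1, h2⟩
    have h1' := coz_le_of_dvd (Ideal.mem_span_singleton.1 h1)
    have h2' := coz_le_of_dvd (Ideal.mem_span_singleton.1 h2)
    exact eq_zero_of_coz_eq_bot (le_bot_iff.1 (hφψ ▸ le_inf h1' h2'))
  refine (h (Ideal.span {φ}) (Ideal.span {ψ}) ?_).imp (key φ) (key ψ)
  rw [hinf]
  rintro α _ rfl hα
  rw [coz_zero, compl_bot, compl_top, le_bot_iff] at hα
  exact eq_zero_of_coz_eq_bot hα

theorem isPFFrame_of_add
    (h1 : ∀ I J : Ideal (RL L), IsDIdeal I → IsDIdeal J → IsDIdeal (I + J) ∨ I + J = ⊤)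
    (h2 : ∀ I J : Ideal (RL L), IsDIdeal (I + J) → I + J ≠ ⊤ → IsDIdeal I ∨ IsDIdeal J) :
    IsPFFrame L := by
  rintro _ ⟨φ, rfl⟩ _ ⟨ψ, rfl⟩ hφψ
  by_cases hφ0 : φ = 0
  · left
    rw [hφ0, coz_zero]
    exact isComplemented_bot
  -- Everything in `A + B` below is disjoint from the nonzero `η`, which keeps that sum proper.
  -- Passing from `φ` to `φ * κ` makes room for `η`.
  obtain ⟨η, κ, hη, hηκ, hηφ, hφκ⟩ := exists_separation hφ0
  have hψη : coz η ≤ (coz ψ)ᶜ := le_compl_iff_disjoint_right.2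
    (disjoint_iff.2 hφψ |>.mono_left hηφ)
  -- Membership in `A` means cozero below `(coz φ)ᶜᶜ ⊓ (coz η)ᶜ`; in `B`, below `(coz ψ)ᶜᶜ`. Hence
  -- `ψ` annihilates `A` and `φ` annihilates `B`.
  set A : Ideal (RL L) := disjointIdeal ((coz φ)ᶜ ⊔ coz η) with hA
  set B : Ideal (RL L) := disjointIdeal (coz ψ)ᶜ with hB
  have hAφ : ∀ χ ∈ A, ψ * χ = 0 := by
    intro χ hχ
    rw [hA, mem_disjointIdeal, compl_sup] at hχ
    have : coz ψ ≤ (coz φ)ᶜ := le_compl_iff_disjoint_left.2 (disjoint_iff.2 hφψ)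
    exact mul_eq_zero_iff.2 ((disjoint_compl_right.mono this (hχ.trans inf_le_left)).eq_bot)
  have hBφ : ∀ χ ∈ B, φ * χ = 0 := by
    intro χ hχ
    have : coz φ ≤ (coz ψ)ᶜ := le_compl_iff_disjoint_right.2 (disjoint_iff.2 hφψ)
    exact mul_eq_zero_iff.2 ((disjoint_compl_right.mono this hχ).eq_bot)
  have hφκA : φ * κ ∈ A := by
    rw [hA, mem_disjointIdeal, compl_sup, coz_mul]
    exact inf_le_inf le_compl_compl
      (le_compl_iff_disjoint_left.2 (disjoint_iff.2 (mul_eq_zero_iff.1 hηκ)))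
  have hψB : ψ ∈ B := le_compl_compl
  -- The ideals on the left need not be d-ideals, but their sum is the sum of two d-ideals.
  have hsum : (Ideal.span {φ * κ} ⊔ B) + (A ⊔ Ideal.span {ψ}) = A + B := by
    apply le_antisymm
    · refine sup_le (sup_le ?_ le_sup_right) (sup_le le_sup_left ?_)
      · exact ((Ideal.span_singleton_le_iff_mem A).2 hφκA).trans le_sup_left
      · exact ((Ideal.span_singleton_le_iff_mem B).2 hψB).trans le_sup_right
    · exact sup_le (le_sup_left.trans le_sup_right) (le_sup_right.trans le_sup_left)
  have hle : A + B ≤ disjointIdeal (coz η) := by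
    refine sup_le (fun χ hχ => ?_) fun χ hχ => ?_
    · exact (mem_disjointIdeal.1 hχ).trans (compl_le_compl le_sup_right)
    · exact (mem_disjointIdeal.1 hχ).trans (compl_le_compl hψη)
  have hne : A + B ≠ ⊤ := by
    intro htop
    have h1 : (1 : RL L) ∈ disjointIdeal (coz η) := hle (htop ▸ Submodule.mem_top)
    rw [mem_disjointIdeal, coz_one, le_compl_iff_disjoint_right,
      top_disjoint] at h1
    exact hη (eq_zero_of_coz_eq_bot h1)
  have hd : IsDIdeal (A + B) :=
    (h1 A B (isDIdeal_disjointIdeal _) (isDIdeal_disjointIdeal _)).resolve_right hne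
  rcases h2 _ _ (hsum ▸ hd) (hsum ▸ hne) with hI | hJ
  · left
    obtain ⟨ρ, hρ⟩ := exists_cube_root (φ * κ)
    have hmem : ρ ∈ Ideal.span {φ * κ} ⊔ B := hI.mem_of_dvd_pow
      (Submodule.mem_sup_left (Ideal.mem_span_singleton_self _)) three_ne_zero hρ
    obtain ⟨_, hx, y, hy, rfl⟩ := Submodule.mem_sup.1 hmem
    obtain ⟨υ, rfl⟩ := Ideal.mem_span_singleton.1 hx
    obtain ⟨d, hd⟩ := isComplemented_coz_of_dvd (υ := υ) hρ
      (by linear_combination κ * hBφ y hy)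
    -- As `coz φ ⊔ coz κ = ⊤`, a complement `d` of `coz φ ⊓ coz κ` yields the complement `coz κ ⊓ d`
    -- of `coz φ`.
    refine ⟨coz κ ⊓ d, IsCompl.of_eq ?_ ?_⟩
    · rw [← inf_assoc, ← coz_mul]
      exact hd.inf_eq_bot
    · rw [sup_inf_left, hφκ, top_inf_eq, eq_top_iff, ← hd.sup_eq_top]
      exact sup_le_sup_right (coz_le_of_dvd ⟨κ, rfl⟩) d
  · right
    obtain ⟨ρ, hρ⟩ := exists_cube_root ψ
    have hmem : ρ ∈ A ⊔ Ideal.span {ψ} := hJ.mem_of_dvd_pow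
      (Submodule.mem_sup_right (Ideal.mem_span_singleton_self _)) three_ne_zero hρ
    obtain ⟨x, hx, _, hy, rfl⟩ := Submodule.mem_sup.1 hmem
    obtain ⟨υ, rfl⟩ := Ideal.mem_span_singleton.1 hy
    exact isComplemented_coz_of_dvd (υ := υ) hρ (by linear_combination hAφ x hx)

end PointfreeReal

theorem mainTheorem4 {L : Type*} [Order.Frame L] (hL : PointfreeReal.IsCompletelyRegular L) :
    List.TFAE [
      (∀ I J : Ideal (PointfreeReal.RL L), PointfreeReal.IsDIdeal I → PointfreeReal.IsDIdeal J →
          PointfreeReal.IsDIdeal (I + J) ∨ I + J = ⊤) ∧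
        (∀ I J : Ideal (PointfreeReal.RL L), PointfreeReal.IsDIdeal (I + J) → I + J ≠ ⊤ →
          PointfreeReal.IsDIdeal I ∨ PointfreeReal.IsDIdeal J),
      PointfreeReal.IsPFFrame L,
      ∀ I J : Ideal (PointfreeReal.RL L), PointfreeReal.IsDIdeal (I ⊓ J) →
        PointfreeReal.IsDIdeal I ∨ PointfreeReal.IsDIdeal J] := by
  tfae_have 1 → 2 := fun h => PointfreeReal.isPFFrame_of_add h.1 h.2
  tfae_have 2 → 1 := fun h => ⟨fun _ _ hI hJ => Or.inl (h.isDIdeal_add hI hJ),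
    fun _ _ hIJ _ => h.isDIdeal_or_of_add hIJ⟩
  tfae_have 2 → 3 := fun h _ _ => h.isDIdeal_or_of_inf
  tfae_have 3 → 2 := PointfreeReal.isPFFrame_of_inf
  tfae_finish
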